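/- Let $G_0$ be the complete graph on two vertices, its edge labelled $a$; both vertices are called boundary vertices. For $n\ge 0$ let $G_{n+1}$ be the finite multigraph, with edges labelled $a$ or $b$, obtained from $G_n$ by relabelling every $b$-edge as an $a$-edge and replacing every $a$-edge joining $p$ and $q$ (with $p=q$ for a loop) by a new vertex that carries an $a$-loop and is joined by one $b$-edge to $p$ and by one $b$-edge to $q$; the boundary $\partial G_{n+1}$ consists of the same two vertices as $\partial G_n$. (For $n\ge1$ these are the graphs obtained from the Schreier graph of the Basilica group on words of length $n$ by splitting the vertex $0^n$ into four vertices, one for each incident half-edge, and keeping the larger of the two components.) Let $c_{xy}$ be the number of edges joining $x$ and $y$. The Neumann Laplacian $L_n$ on $\mathbb{R}^{G_n}$ is $L_nf(x)=\sum_y c_{xy}(f(x)-f(y))$, and the Dirichlet Laplacian $L_n^D$ on $\mathbb{R}^{G_n\setminus\partial G_n}$ is given by the same formula, with functions extended by $0$ to $\partial G_n$. The (Neumann or Dirichlet) spectral measure of $G_n$ is the sum of the Dirac masses at the eigenvalues of $L_n$, respectively $L_n^D$, repeated according to multiplicity, divided by the dimension of the space on which the operator acts. The KNS (Kesten--von Neumann--Serre)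 spectral measure is the probability measure on $\mathbb{R}$ that is the weak limit, as $n\to\infty$, of the Neumann spectral measures of the $G_n$. **Theorem.** There are constants $c,C>0$ such that for every $\epsilon>0$ there is an integer $m\ge 1$ with $$c\,|\log\epsilon|\le m\le C\,(1+|\log\epsilon|)$$ for which the following hold. 1. For all $n\ge m$, the Dirichlet spectral measure of $G_n$ gives mass at most $\epsilon$ to the complement of the set of eigenvalues of $L_m^D$, and the Neumann spectral measure of $G_n$ gives mass at most $\epsilon$ to the complement of the set of eigenvalues of $L_m$. 2. The KNS spectral measure gives mass at most $\epsilon$ to the complement of the set of eigenvalues of $L_m^D$ and to the complement of the set of eigenvalues of $L_m$. -/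

import Mathlib

open scoped ENNReal BoundedContinuousFunction
open Filter Topology MeasureTheory

noncomputable section

namespace Basilica

/-- A finite multigraph (loops and multiple edges allowed) whose edges are labelled `a` or `b`,
with two marked vertices, its boundary. Every edge is stored with an (immaterial) order
of its two end points. -/
structure LabelledGraph where
  V : Type
  AEdge : Type
  BEdge : Type
  [fintypeV : Fintype V]
  [fintypeA : Fintype AEdge]
  [fintypeB : Fintype BEdge]
  aEnds : AEdge → V × V
  bEnds : BEdge → V × V
  left : V
  right : V

attribute [instance] LabelledGraph.fintypeV LabelledGraph.fintypeA LabelledGraph.fintypeB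

namespace LabelledGraph

/-- One application of the replacement rules of the Schreier graphs of the Basilica group:
* every `b`-edge becomes an `a`-edge with the same end points;
* every `a`-edge `{p, q}` (where `p = q` for an `a`-loop) is removed, and a new vertex is added,
  which is joined to `p` by a `b`-edge, to `q` by another `b`-edge, and to itself by an `a`-loop.
The old vertices, and the boundary among them, are kept. -/
def replace (G : LabelledGraph) : LabelledGraph where
  V := G.V ⊕ G.AEdge
  AEdge := G.BEdge ⊕ G.AEdge
  BEdge := G.AEdge ⊕ G.AEdge
  aEnds := Sum.elim
    (fun e => (Sum.inl (G.bEnds e).1, Sum.inl (G.bEnds e).2))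
    (fun e => (Sum.inr e, Sum.inr e))
  bEnds := Sum.elim
    (fun e => (Sum.inl (G.aEnds e).1, Sum.inr e))
    (fun e => (Sum.inr e, Sum.inl (G.aEnds e).2))
  left := Sum.inl G.left
  right := Sum.inl G.right

/-- `c_{xy}`: the number of edges, of either label, that join `x` and `y`. -/
def edgeCount (G : LabelledGraph) (x y : G.V) : ℕ :=
  Nat.card {e : G.AEdge // s((G.aEnds e).1, (G.aEnds e).2) = s(x, y)} +
    Nat.card {e : G.BEdge // s((G.bEnds e).1, (G.bEnds e).2) = s(x, y)}

/-- The (Neumann) Laplacian `L f (x) = ∑ y, c_{xy} (f x - f y)` on all functions on the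
vertices. -/
def laplacian (G : LabelledGraph) : Module.End ℝ (G.V → ℝ) where
  toFun f x := ∑ y, (G.edgeCount x y : ℝ) * (f x - f y)
  map_add' f g := by
    ext x
    simp only [Pi.add_apply, ← Finset.sum_add_distrib]
    exact Finset.sum_congr rfl fun y _ => by ring
  map_smul' r f := by
    ext x
    simp only [Pi.smul_apply, smul_eq_mul, RingHom.id_apply, Finset.mul_sum]
    exact Finset.sum_congr rfl fun y _ => by ring

/-- The vertices that are not boundary vertices. -/
abbrev Interior (G : LabelledGraph) : Type := {x : G.V // x ≠ G.left ∧ x ≠ G.right}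

/-- The Dirichlet Laplacian: the same formula on the functions on the non-boundary vertices, which
are understood to vanish on the boundary. -/
def dirichletLaplacian (G : LabelledGraph) : Module.End ℝ (G.Interior → ℝ) :=
  LinearMap.funLeft ℝ ℝ Subtype.val ∘ₗ G.laplacian ∘ₗ
    Function.ExtendByZero.linearMap ℝ Subtype.val

end LabelledGraph

/-- The graphs `G_n`: `G_0` is the complete graph on two vertices, both of them boundary vertices,
with its edge labelled `a`, and `G_{n+1}` arises from `G_n` by the replacement rules. -/
def G : ℕ → LabelledGraph
  | 0 =>
    { V := Bool
      AEdge := Unit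
      BEdge := Empty
      aEnds := fun _ => (false, true)
      bEnds := Empty.elim
      left := false
      right := true }
  | n + 1 => (G n).replace

/-- The set of (real) eigenvalues of an operator. -/
def eigenvalues {M : Type*} [AddCommGroup M] [Module ℝ M] (T : Module.End ℝ M) : Set ℝ :=
  {μ | T.HasEigenvalue μ}

/-- The spectral measure of an operator with real spectrum on a finite dimensional space: the sum of
the Dirac masses at its eigenvalues, repeated according to multiplicity (as roots of the
characteristic polynomial), divided by the dimension. -/
def spectralMeasure {M : Type*} [AddCommGroup M] [Module ℝ M] [Module.Finite ℝ M]
    (T : Module.End ℝ M) : Measure ℝ :=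
  (Module.finrank ℝ M : ℝ≥0∞)⁻¹ • (T.charpoly.roots.map fun μ => Measure.dirac μ).sum

/-- `χ` is the Kesten--von Neumann--Serre spectral measure: the probability measure that is the weak
limit of the spectral measures of the Neumann Laplacians of the `G_n`. -/
def IsKNSMeasure (χ : Measure ℝ) : Prop :=
  IsProbabilityMeasure χ ∧
    ∀ f : ℝ →ᵇ ℝ,
      Tendsto (fun n => ∫ x, f x ∂(spectralMeasure (G n).laplacian)) atTop (𝓝 (∫ x, f x ∂χ))

end Basilica

end

noncomputable section

namespace Basilica

open Module

/-! ### Spectral measures -/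

section SpectralMeasure

variable {M : Type*} [AddCommGroup M] [Module ℝ M] [Module.Finite ℝ M]

/-! Call an eigenfunction of L_n localized if it vanishes on the boundary. The eigenvalue equation
holds at the boundary too, so such a function is a Neumann eigenfunction, restricts to a Dirichlet
one, and, extended by zero, remains an eigenfunction in every graph that contains G_n attached only
along its boundary (`Emb.laplacian_pushforward`). Hence the localized spectrum of G_m consists of
eigenvalues of both L_m and L_m^D, and it suffices that localized eigenfunctions with these
eigenvalues span almost all functions on G_n for every n ≥ m.

On a single G_n, let K be an L_n-invariant space containing the two boundary indicators. Its
orthogonal complement is invariant and consists of functions vanishing on the boundary, so it is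
spanned by localized eigenfunctions. A small K can be carried through the replacement rules: the
part growing out of a loop is mirror symmetric, and functions symmetric there suffice.
`InvariantSystem.replace` encodes this by asking for equal values on the two halves of each new
a-loop. The resulting K has dimension O(1.9^n), against order 2^n vertices
(`card_le_finrank_localizedSpan`).

Finally G_{k+m+1} is G_k with its edges replaced by copies of G_{m+1} and G_m. Adding up localized
functions over these disjoint copies (`Emb.sum_finrank_localizedSpan_le`) leaves codimension O(2^k
1.9^m), a proportion O(0.95^m) uniformly in k. An m of order 1 + |log ε| makes this at most ε, and
the portmanteau theorem passes the bound to the KNS measure. -/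

lemma spectralMeasure_apply (T : Module.End ℝ M) (S : Set ℝ) (hS : MeasurableSet S)
    [DecidablePred (· ∈ S)] :
    spectralMeasure T S =
      (finrank ℝ M : ℝ≥0∞)⁻¹ * ((T.charpoly.roots.filter (· ∈ S)).card : ℝ≥0∞) := by
  have key : ∀ R : Multiset ℝ, (R.map fun μ => Measure.dirac μ).sum S =
      ((R.filter (· ∈ S)).card : ℝ≥0∞) := by
    intro R
    induction R using Multiset.induction_on with
    | empty => simp
    | cons a R ih =>
      by_cases ha : a ∈ S <;> simp [ha, ih, Measure.dirac_apply' a hS, add_comm]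
  simp [spectralMeasure, key]

/-- The eigenvalues in `S` account, with multiplicity, for at least the dimension of any subspace
of the sum of their eigenspaces. -/
lemma finrank_le_card_filter_roots (T : Module.End ℝ M) (S : Set ℝ) [DecidablePred (· ∈ S)]
    (U : Submodule ℝ M) (hU : U ≤ ⨆ μ ∈ S, T.eigenspace μ) :
    finrank ℝ U ≤ (T.charpoly.roots.filter (· ∈ S)).card := by
  classical
  set R := T.charpoly.roots.toFinset.filter (· ∈ S)
  -- Points of S that are not roots of the characteristic polynomial have zero eigenspace, so a
  -- finite supremum suffices.
  have h1 : (⨆ μ ∈ S, T.eigenspace μ) ≤ ⨆ μ ∈ R, T.eigenspace μ := by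
    refine iSup₂_le fun μ hμ => ?_
    by_cases hr : μ ∈ R
    · exact le_iSup₂_of_le μ hr le_rfl
    · have h0 : T.charpoly.rootMultiplicity μ = 0 := by
        rw [← Polynomial.count_roots, Multiset.count_eq_zero]
        intro h
        exact hr (by simp [R, hμ, -Polynomial.mem_roots', h])
      have := T.finrank_eigenspace_le μ
      rw [h0, Nat.le_zero, Submodule.finrank_eq_zero] at this
      simp [this]
  have h2 : ∀ Q : Finset ℝ, finrank ℝ (⨆ μ ∈ Q, T.eigenspace μ : Submodule ℝ M) ≤
      ∑ μ ∈ Q, finrank ℝ (T.eigenspace μ) := by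
    intro Q
    induction Q using Finset.induction_on with
    | empty => simp
    | insert a Q ha ih =>
      rw [Finset.iSup_insert, Finset.sum_insert ha]
      exact (Submodule.finrank_add_le_finrank_add_finrank _ _).trans (by gcongr)
  calc finrank ℝ U ≤ finrank ℝ (⨆ μ ∈ R, T.eigenspace μ : Submodule ℝ M) :=
        Submodule.finrank_mono (hU.trans h1)
    _ ≤ ∑ μ ∈ R, finrank ℝ (T.eigenspace μ) := h2 R
    _ ≤ ∑ μ ∈ R, T.charpoly.roots.count μ := Finset.sum_le_sum fun μ _ => by
        rw [Polynomial.count_roots]; exact T.finrank_eigenspace_le μ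
    _ = ∑ μ ∈ (T.charpoly.roots.filter (· ∈ S)).toFinset,
          (T.charpoly.roots.filter (· ∈ S)).count μ := by
        rw [Multiset.toFinset_filter]
        refine Finset.sum_congr rfl fun μ hμ => ?_
        rw [Multiset.count_filter_of_pos (Finset.mem_filter.1 hμ).2]
    _ = _ := Multiset.toFinset_sum_count_eq _

lemma card_roots_charpoly_le (T : Module.End ℝ M) : T.charpoly.roots.card ≤ finrank ℝ M :=
  (Polynomial.card_roots' _).trans T.charpoly_natDegree.le

/-- There are at most dim M roots in all, and at least dim U of them lie in S, so at most dim M -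
dim U lie outside. -/
lemma spectralMeasure_compl_le (T : Module.End ℝ M) (S : Set ℝ) (hS : MeasurableSet S)
    (U : Submodule ℝ M) (hU : U ≤ ⨆ μ ∈ S, T.eigenspace μ) (hM : 0 < finrank ℝ M) {δ : ℝ}
    (hδ : (finrank ℝ M : ℝ) - finrank ℝ U ≤ δ * finrank ℝ M) :
    spectralMeasure T Sᶜ ≤ ENNReal.ofReal δ := by
  classical
  rw [spectralMeasure_apply T _ hS.compl]
  have h1 := finrank_le_card_filter_roots T S U hU
  have h2 := card_roots_charpoly_le T
  have h3 := congrArg Multiset.card (Multiset.filter_add_not (· ∈ S) T.charpoly.roots)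
  rw [Multiset.card_add] at h3
  have h4 : (T.charpoly.roots.filter (· ∈ Sᶜ)).card =
      (T.charpoly.roots.filter (· ∉ S)).card := rfl
  rw [h4]
  set k := (T.charpoly.roots.filter (· ∉ S)).card
  have h5 : (k : ℝ) ≤ δ * finrank ℝ M := by
    have : (k : ℝ) + finrank ℝ U ≤ finrank ℝ M := by exact_mod_cast (by omega)
    linarith
  have hM' : (0 : ℝ) < finrank ℝ M := by exact_mod_cast hM
  rw [ENNReal.inv_mul_le_iff (by simpa using hM.ne') (by simp),
    ← ENNReal.ofReal_natCast (finrank ℝ M), ← ENNReal.ofReal_natCast k,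
    ← ENNReal.ofReal_mul hM'.le]
  exact ENNReal.ofReal_le_ofReal (by linarith)

lemma isProbabilityMeasure_spectralMeasure (T : Module.End ℝ M) (hT : ⨆ μ, T.eigenspace μ = ⊤)
    (hM : 0 < finrank ℝ M) : IsProbabilityMeasure (spectralMeasure T) := by
  classical
  refine ⟨?_⟩
  rw [spectralMeasure_apply T _ MeasurableSet.univ]
  have h1 := finrank_le_card_filter_roots T Set.univ ⊤ (by simp [hT])
  have h2 := card_roots_charpoly_le T
  have h3 := Multiset.card_le_card (Multiset.filter_le (· ∈ Set.univ) T.charpoly.roots)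
  rw [finrank_top] at h1
  rw [show (T.charpoly.roots.filter (· ∈ Set.univ)).card = finrank ℝ M by omega]
  exact ENNReal.inv_mul_cancel (by simpa using hM.ne') (by simp)

lemma finite_eigenvalues (T : Module.End ℝ M) : (eigenvalues T).Finite :=
  T.finite_hasEigenvalue

end SpectralMeasure

/-! ### Symmetric operators on functions on a finite type -/

section Symmetric

variable {V : Type*} [Fintype V]

open scoped RealInnerProductSpace in
lemma iSup_eigenspace_eq_top_of_symmetric (T : Module.End ℝ (V → ℝ))
    (hT : ∀ f g : V → ℝ, T f ⬝ᵥ g = f ⬝ᵥ T g) : ⨆ μ, T.eigenspace μ = ⊤ := by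
  -- The spectral theorem is applied on Euclidean space and transported back.
  set e := WithLp.linearEquiv 2 ℝ (V → ℝ)
  let T' : Module.End ℝ (EuclideanSpace ℝ V) := e.symm.conj T
  have hinner : ∀ x y : EuclideanSpace ℝ V, ⟪x, y⟫ = e x ⬝ᵥ e y := fun x y => by
    rw [EuclideanSpace.inner_eq_star_dotProduct, dotProduct_comm]; rfl
  have hs : LinearMap.IsSymmetric T' := fun x y => by
    rw [hinner, hinner]
    simpa [T', LinearEquiv.conj_apply] using hT (e x) (e y)
  have h := Submodule.orthogonal_eq_bot_iff.1 hs.orthogonalComplement_iSup_eigenspaces_eq_bot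
  rw [eq_top_iff]
  intro f _
  have hf : e.symm f ∈ ⨆ μ, T'.eigenspace μ := h ▸ Submodule.mem_top
  have hle : (⨆ μ, T'.eigenspace μ) ≤ (⨆ μ, T.eigenspace μ).comap (e : _ →ₗ[ℝ] _) := by
    refine iSup_le fun μ x hx => Submodule.mem_iSup_of_mem μ ?_
    rw [Module.End.mem_eigenspace_iff] at hx ⊢
    have := congrArg e hx
    simpa [T', LinearEquiv.conj_apply] using this
  simpa using hle hf

/-- The functions orthogonal to `K`. -/
def orthogonal (K : Submodule ℝ (V → ℝ)) : Submodule ℝ (V → ℝ) :=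
  LinearMap.BilinForm.orthogonal (dotProductBilin ℝ ℝ) K

lemma mem_orthogonal {K : Submodule ℝ (V → ℝ)} {f : V → ℝ} :
    f ∈ orthogonal K ↔ ∀ g ∈ K, g ⬝ᵥ f = 0 := Iff.rfl

lemma card_le_finrank_add_finrank_orthogonal (K : Submodule ℝ (V → ℝ)) :
    Fintype.card V ≤ finrank ℝ K + finrank ℝ (orthogonal K) := by
  have := LinearMap.BilinForm.finrank_add_finrank_orthogonal' (B := dotProductBilin ℝ ℝ) K
  rw [Module.finrank_fintype_fun_eq_card] at this
  unfold orthogonal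
  omega

/-- By symmetry the complement of an invariant space is invariant, and a diagonalizable operator
stays diagonalizable on an invariant subspace. -/
lemma orthogonal_eq_iSup_eigenspace (T : Module.End ℝ (V → ℝ))
    (hT : ∀ f g : V → ℝ, T f ⬝ᵥ g = f ⬝ᵥ T g) (K : Submodule ℝ (V → ℝ))
    (hK : ∀ f ∈ K, T f ∈ K) : orthogonal K = ⨆ μ, orthogonal K ⊓ T.eigenspace μ :=
  Submodule.eq_iSup_inf_genEigenspace 1
    (fun f hf => mem_orthogonal.2 fun g hg => by
      rw [← hT]; exact mem_orthogonal.1 hf _ (hK g hg))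
    (iSup_eigenspace_eq_top_of_symmetric T hT)

end Symmetric

/-! ### The Laplacian as a sum over edges -/

section PushPull

variable {V E : Type*}

/-- The values of a function on vertices at the starting points of the half-edges. -/
def pull (ends : E → V × V) (f : V → ℝ) : (E → ℝ) × (E → ℝ) :=
  (fun e => f (ends e).1, fun e => f (ends e).2)

variable [Fintype E]

open scoped Classical in
/-- The sum, at each vertex, of the values on the half-edges that start there; `h.1` holds the
values on the half-edges at the first end points, `h.2` those at the second end points. -/
def push (ends : E → V × V) (h : (E → ℝ) × (E → ℝ)) (x : V) : ℝ :=
  ∑ e, ((if (ends e).1 = x then h.1 e else 0) + if (ends e).2 = x then h.2 e else 0)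

lemma push_apply [DecidableEq V] (ends : E → V × V) (h : (E → ℝ) × (E → ℝ)) (x : V) :
    push ends h x =
      ∑ e, ((if (ends e).1 = x then h.1 e else 0) + if (ends e).2 = x then h.2 e else 0) := by
  unfold push
  congr!

open scoped Classical in
lemma dotProduct_push [Fintype V] (ends : E → V × V) (h : (E → ℝ) × (E → ℝ)) (g : V → ℝ) :
    g ⬝ᵥ push ends h = ∑ e, (g (ends e).1 * h.1 e + g (ends e).2 * h.2 e) := by
  simp only [dotProduct, push, Finset.mul_sum]
  rw [Finset.sum_comm]
  refine Finset.sum_congr rfl fun e _ => ?_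
  simp [mul_add, Finset.sum_add_distrib]

open scoped Classical in
-- An edge pq contributes f p - f q at p and f q - f p at q; a loop contributes zero on both sides.
lemma sum_card_mul_sub [Fintype V] (ends : E → V × V) (f : V → ℝ) (x : V) :
    ∑ y, (Nat.card {e : E // s((ends e).1, (ends e).2) = s(x, y)} : ℝ) * (f x - f y) =
      push ends (pull ends f - (pull ends f).swap) x := by
  have h : ∀ y, (Nat.card {e : E // s((ends e).1, (ends e).2) = s(x, y)} : ℝ) =
      ∑ e, if s((ends e).1, (ends e).2) = s(x, y) then (1 : ℝ) else 0 := fun y => by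
    rw [Nat.card_eq_fintype_card, Fintype.card_subtype, Finset.sum_boole]
  simp only [h, Finset.sum_mul, push]
  rw [Finset.sum_comm]
  refine Finset.sum_congr rfl fun e _ => ?_
  rcases hE : ends e with ⟨p, q⟩
  simp only [pull, Prod.fst_sub, Prod.snd_sub, Prod.fst_swap, Prod.snd_swap, Pi.sub_apply, hE,
    Sym2.eq_iff, ite_mul, one_mul, zero_mul]
  by_cases hp : p = x <;> by_cases hq : q = x
  · subst hp; subst hq
    simp
  · subst hp
    simp [hq]
  · subst hq
    simp [hp]
  · simp [hp, hq]

end PushPull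

namespace LabelledGraph

variable (G : LabelledGraph)

lemma laplacian_eq_push (f : G.V → ℝ) : G.laplacian f =
    push G.aEnds (pull G.aEnds f - (pull G.aEnds f).swap) +
      push G.bEnds (pull G.bEnds f - (pull G.bEnds f).swap) := by
  ext x
  rw [Pi.add_apply, ← sum_card_mul_sub, ← sum_card_mul_sub, ← Finset.sum_add_distrib]
  simp only [laplacian, edgeCount, LinearMap.coe_mk, AddHom.coe_mk]
  refine Finset.sum_congr rfl fun y _ => ?_
  push_cast
  ring

lemma laplacian_symmetric (f g : G.V → ℝ) : G.laplacian f ⬝ᵥ g = f ⬝ᵥ G.laplacian g := by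
  rw [dotProduct_comm, laplacian_eq_push, laplacian_eq_push, dotProduct_add, dotProduct_add]
  simp only [dotProduct_push, pull, Prod.fst_sub, Prod.snd_sub, Prod.fst_swap, Prod.snd_swap,
    Pi.sub_apply]
  congr 1 <;> exact Finset.sum_congr rfl fun e _ => by ring

/-- The functions that vanish on the boundary. -/
def vanishing : Submodule ℝ (G.V → ℝ) where
  carrier := {f | f G.left = 0 ∧ f G.right = 0}
  add_mem' hf hg := by simp_all
  zero_mem' := by simp
  smul_mem' c f hf := by simp_all

lemma mem_vanishing {f : G.V → ℝ} : f ∈ G.vanishing ↔ f G.left = 0 ∧ f G.right = 0 := Iff.rfl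

/-- The eigenvalues of the Laplacian that have an eigenfunction which vanishes on the boundary. -/
def localizedSpectrum : Set ℝ :=
  {μ | ∃ f ∈ G.vanishing, f ≠ 0 ∧ G.laplacian f = μ • f}

lemma localizedSpectrum_subset_eigenvalues :
    G.localizedSpectrum ⊆ eigenvalues G.laplacian := by
  rintro μ ⟨f, -, hf, h⟩
  exact Module.End.hasEigenvalue_of_hasEigenvector ⟨Module.End.mem_eigenspace_iff.2 h, hf⟩

/-- Restriction to the interior. -/
def restrict : (G.V → ℝ) →ₗ[ℝ] (G.Interior → ℝ) := LinearMap.funLeft ℝ ℝ Subtype.val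

variable {G}

lemma extend_restrict {f : G.V → ℝ} (hf : f ∈ G.vanishing) :
    Function.ExtendByZero.linearMap ℝ (Subtype.val : G.Interior → G.V) (G.restrict f) = f := by
  ext x
  by_cases hx : x ≠ G.left ∧ x ≠ G.right
  · exact Subtype.val_injective.extend_apply (G.restrict f) 0 ⟨x, hx⟩
  · have h0 : f x = 0 := by
      rw [mem_vanishing] at hf
      by_contra h
      exact hx ⟨fun h' => h (h' ▸ hf.1), fun h' => h (h' ▸ hf.2)⟩
    rw [h0]
    refine Function.extend_apply' _ _ _ ?_
    rintro ⟨y, rfl⟩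
    exact hx y.2

lemma restrict_injOn : Set.InjOn G.restrict G.vanishing := fun f hf g hg h => by
  rw [← extend_restrict hf, h, extend_restrict hg]

lemma dirichletLaplacian_restrict {f : G.V → ℝ} {μ : ℝ} (hf : f ∈ G.vanishing)
    (h : G.laplacian f = μ • f) : G.dirichletLaplacian (G.restrict f) = μ • G.restrict f := by
  simp only [dirichletLaplacian, LinearMap.comp_apply, extend_restrict hf, h]
  exact map_smul G.restrict μ f

variable (G)

lemma localizedSpectrum_subset_eigenvalues_dirichlet :
    G.localizedSpectrum ⊆ eigenvalues G.dirichletLaplacian := by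
  rintro μ ⟨f, hv, hf, h⟩
  refine Module.End.hasEigenvalue_of_hasEigenvector (x := G.restrict f)
    ⟨Module.End.mem_eigenspace_iff.2 (dirichletLaplacian_restrict hv h), fun h0 => hf ?_⟩
  exact restrict_injOn hv (zero_mem _) (by simpa using h0)

/-- The span of the eigenfunctions that vanish on the boundary, with eigenvalue in `S`. -/
def localizedSpan (S : Set ℝ) : Submodule ℝ (G.V → ℝ) :=
  ⨆ μ ∈ S, G.vanishing ⊓ G.laplacian.eigenspace μ

lemma localizedSpan_le (S : Set ℝ) :
    G.localizedSpan S ≤ ⨆ μ ∈ S, G.laplacian.eigenspace μ :=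
  iSup₂_mono fun _ _ => inf_le_right

lemma localizedSpan_le_vanishing (S : Set ℝ) : G.localizedSpan S ≤ G.vanishing :=
  iSup₂_le fun _ _ => inf_le_left

lemma map_restrict_localizedSpan_le (S : Set ℝ) :
    (G.localizedSpan S).map G.restrict ≤ ⨆ μ ∈ S, G.dirichletLaplacian.eigenspace μ := by
  simp only [localizedSpan, Submodule.map_iSup]
  refine iSup₂_mono fun μ _ => ?_
  rintro _ ⟨f, ⟨hv, h⟩, rfl⟩
  exact Module.End.mem_eigenspace_iff.2
    (dirichletLaplacian_restrict hv (Module.End.mem_eigenspace_iff.1 h))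

lemma finrank_map_restrict_localizedSpan (S : Set ℝ) :
    finrank ℝ ((G.localizedSpan S).map G.restrict) = finrank ℝ (G.localizedSpan S) := by
  refine (LinearEquiv.finrank_eq (LinearEquiv.ofBijective
    (G.restrict.submoduleMap (G.localizedSpan S)) ⟨fun f g h => ?_, ?_⟩)).symm
  · exact Subtype.ext (restrict_injOn (G.localizedSpan_le_vanishing S f.2)
      (G.localizedSpan_le_vanishing S g.2) (congrArg Subtype.val h))
  · exact LinearMap.submoduleMap_surjective _ _

end LabelledGraph

/-! ### Embeddings that are open in the interior -/

/-- A morphism of labelled graphs that is injective on edges, maps the interior injectively to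
the interior and away from the image of the boundary, and is such that every edge at the image of
an interior vertex comes from an edge. -/
structure Emb (A H : LabelledGraph) where
  v : A.V → H.V
  a : A.AEdge → H.AEdge
  b : A.BEdge → H.BEdge
  a_inj : Function.Injective a
  b_inj : Function.Injective b
  aEnds_map : ∀ e, H.aEnds (a e) = (v (A.aEnds e).1, v (A.aEnds e).2)
  bEnds_map : ∀ e, H.bEnds (b e) = (v (A.bEnds e).1, v (A.bEnds e).2)
  eq_of_interior : ∀ x : A.Interior, ∀ y, v x = v y → x = y
  interior : ∀ x : A.Interior, v x ≠ H.left ∧ v x ≠ H.right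
  aEdge_mem : ∀ x : A.Interior, ∀ e,
    (H.aEnds e).1 = v x ∨ (H.aEnds e).2 = v x → e ∈ Set.range a
  bEdge_mem : ∀ x : A.Interior, ∀ e,
    (H.bEnds e).1 = v x ∨ (H.bEnds e).2 = v x → e ∈ Set.range b

namespace LabelledGraph

lemma interior_replace_cases {A : LabelledGraph} (x : A.replace.Interior) :
    (∃ y : A.Interior, x.1 = Sum.inl y.1) ∨ ∃ e : A.AEdge, x.1 = Sum.inr e := by
  obtain ⟨x | e, hx⟩ := x
  · exact Or.inl ⟨⟨x, fun h => hx.1 (congrArg Sum.inl h), fun h => hx.2 (congrArg Sum.inl h)⟩, rfl⟩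
  · exact Or.inr ⟨e, rfl⟩

end LabelledGraph

namespace Emb

variable {A A' H : LabelledGraph}

/-- The replacement rules are functorial. -/
def replace (φ : Emb A H) : Emb A.replace H.replace where
  v := Sum.map φ.v φ.a
  a := Sum.map φ.b φ.a
  b := Sum.map φ.a φ.a
  a_inj := φ.b_inj.sumMap φ.a_inj
  b_inj := φ.a_inj.sumMap φ.a_inj
  aEnds_map := by
    rintro (e | e) <;> simp [LabelledGraph.replace, φ.bEnds_map]
  bEnds_map := by
    rintro (e | e) <;> simp [LabelledGraph.replace, φ.aEnds_map]
  eq_of_interior := by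
    intro x y h
    rcases LabelledGraph.interior_replace_cases x with ⟨z, hz⟩ | ⟨e, he⟩
    · rw [hz] at h ⊢
      rcases y with y | y
      · exact congrArg Sum.inl (φ.eq_of_interior z y (Sum.inl_injective h))
      · cases h
    · rw [he] at h ⊢
      rcases y with y | y
      · cases h
      · exact congrArg Sum.inr (φ.a_inj (Sum.inr_injective h))
  interior := by
    intro x
    rcases LabelledGraph.interior_replace_cases x with ⟨z, hz⟩ | ⟨e, he⟩
    · rw [hz]
      exact ⟨fun h => (φ.interior z).1 (Sum.inl_injective h),
        fun h => (φ.interior z).2 (Sum.inl_injective h)⟩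
    · rw [he]
      exact ⟨fun h => Sum.inr_ne_inl h, fun h => Sum.inr_ne_inl h⟩
  aEdge_mem := by
    intro x e h
    rcases LabelledGraph.interior_replace_cases x with ⟨z, hz⟩ | ⟨u, hu⟩
    · rw [hz] at h
      rcases e with e | e
      · obtain ⟨e', rfl⟩ := φ.bEdge_mem z e (h.imp Sum.inl_injective.eq_iff.1
          Sum.inl_injective.eq_iff.1)
        exact ⟨Sum.inl e', rfl⟩
      · rcases h with h | h <;> cases h
    · rw [hu] at h
      rcases e with e | e
      · rcases h with h | h <;> cases h
      · have : e = φ.a u := h.elim (fun h => Sum.inr_injective h) fun h => Sum.inr_injective h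
        exact ⟨Sum.inr u, this ▸ rfl⟩
  bEdge_mem := by
    intro x e h
    rcases LabelledGraph.interior_replace_cases x with ⟨z, hz⟩ | ⟨u, hu⟩
    · rw [hz] at h
      rcases e with e | e
      · rcases h with h | h
        · obtain ⟨e', rfl⟩ := φ.aEdge_mem z e (Or.inl (Sum.inl_injective h))
          exact ⟨Sum.inl e', rfl⟩
        · cases h
      · rcases h with h | h
        · cases h
        · obtain ⟨e', rfl⟩ := φ.aEdge_mem z e (Or.inr (Sum.inl_injective h))
          exact ⟨Sum.inr e', rfl⟩
    · rw [hu] at h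
      rcases e with e | e
      · rcases h with h | h
        · cases h
        · have : e = φ.a u := Sum.inr_injective h
          exact ⟨Sum.inl u, this ▸ rfl⟩
      · rcases h with h | h
        · have : e = φ.a u := Sum.inr_injective h
          exact ⟨Sum.inr u, this ▸ rfl⟩
        · cases h

/-- The embedding of a single edge. -/
def ofAEdge (H : LabelledGraph) (e : H.AEdge) : Emb (G 0) H where
  v x := bif x then (H.aEnds e).2 else (H.aEnds e).1
  a _ := e
  b := Empty.elim
  a_inj _ _ _ := rfl
  b_inj := fun x => x.elim
  aEnds_map _ := rfl
  bEnds_map := fun x => x.elim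
  eq_of_interior := by rintro ⟨_ | _, h⟩ <;> simp [G] at h
  interior := by rintro ⟨_ | _, h⟩ <;> simp [G] at h
  aEdge_mem := by rintro ⟨_ | _, h⟩ <;> simp [G] at h
  bEdge_mem := by rintro ⟨_ | _, h⟩ <;> simp [G] at h

/-- Two embeddings whose images have no edge and no interior vertex in common. -/
structure Disj (φ : Emb A H) (ψ : Emb A' H) : Prop where
  v : ∀ (x : A.Interior) (y : A'.Interior), φ.v x ≠ ψ.v y
  a : ∀ x y, φ.a x ≠ ψ.a y
  b : ∀ x y, φ.b x ≠ ψ.b y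

lemma Disj.symm {φ : Emb A H} {ψ : Emb A' H} (h : Disj φ ψ) : Disj ψ φ :=
  ⟨fun x y => (h.v y x).symm, fun x y => (h.a y x).symm, fun x y => (h.b y x).symm⟩

/-- Interior vertices after replacement are old interior vertices or old a-edges, so each kind of
disjointness is inherited. -/
lemma Disj.replace {φ : Emb A H} {ψ : Emb A' H} (h : Disj φ ψ) : Disj φ.replace ψ.replace where
  v x y := by
    rcases LabelledGraph.interior_replace_cases x with ⟨x', hx⟩ | ⟨e, hx⟩ <;>
    rcases LabelledGraph.interior_replace_cases y with ⟨y', hy⟩ | ⟨e', hy⟩ <;>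
    rw [hx, hy]
    · exact fun h' => h.v x' y' (Sum.inl_injective h')
    · exact fun h' => Sum.inl_ne_inr h'
    · exact fun h' => Sum.inr_ne_inl h'
    · exact fun h' => h.a e e' (Sum.inr_injective h')
  a := by
    rintro (x | x) (y | y) h'
    · exact h.b x y (Sum.inl_injective h')
    · cases h'
    · cases h'
    · exact h.a x y (Sum.inr_injective h')
  b := by
    rintro (x | x) (y | y) h'
    · exact h.a x y (Sum.inl_injective h')
    · cases h'
    · cases h'
    · exact h.a x y (Sum.inr_injective h')

/-! ### Push-forward of functions that vanish on the boundary -/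

open scoped Classical in
/-- The sum of a function over the fibres of an embedding. -/
def pushforward (φ : Emb A H) : (A.V → ℝ) →ₗ[ℝ] (H.V → ℝ) where
  toFun f y := ∑ x, if φ.v x = y then f x else 0
  map_add' f g := by
    ext y
    simp only [Pi.add_apply, ← Finset.sum_add_distrib]
    exact Finset.sum_congr rfl fun x _ => by split_ifs <;> simp
  map_smul' c f := by
    ext y
    simp [Finset.mul_sum]

open scoped Classical in
lemma pushforward_apply (φ : Emb A H) (f : A.V → ℝ) (y : H.V) :
    φ.pushforward f y = ∑ x, if φ.v x = y then f x else 0 := rfl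

lemma apply_eq_zero {f : A.V → ℝ} (hf : f ∈ A.vanishing) {x : A.V}
    (hx : ¬(x ≠ A.left ∧ x ≠ A.right)) : f x = 0 := by
  rw [LabelledGraph.mem_vanishing] at hf
  by_contra h
  exact hx ⟨fun h' => h (h' ▸ hf.1), fun h' => h (h' ▸ hf.2)⟩

/-- The push-forward vanishes off the image of the interior. -/
lemma pushforward_eq_zero (φ : Emb A H) {f : A.V → ℝ} (hf : f ∈ A.vanishing) {y : H.V}
    (hy : ∀ x : A.Interior, φ.v x ≠ y) : φ.pushforward f y = 0 := by
  rw [pushforward_apply]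
  refine Finset.sum_eq_zero fun x _ => ?_
  split_ifs with h
  · exact apply_eq_zero hf fun hx => hy ⟨x, hx⟩ h
  · rfl

/-- The two boundary vertices may be identified in H, as for a copy grown from a loop; this is
harmless because f vanishes at both. -/
lemma pushforward_map (φ : Emb A H) {f : A.V → ℝ} (hf : f ∈ A.vanishing) (x : A.V) :
    φ.pushforward f (φ.v x) = f x := by
  by_cases hx : x ≠ A.left ∧ x ≠ A.right
  · rw [pushforward_apply, Finset.sum_eq_single x]
    · simp
    · intro y _ hyx
      exact if_neg fun h => hyx (φ.eq_of_interior ⟨x, hx⟩ y h.symm).symm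
    · simp
  · rw [apply_eq_zero hf hx]
    refine φ.pushforward_eq_zero hf fun z hz => hx ?_
    exact φ.eq_of_interior z x hz ▸ z.2

lemma pushforward_mem_vanishing (φ : Emb A H) {f : A.V → ℝ} (hf : f ∈ A.vanishing) :
    φ.pushforward f ∈ H.vanishing :=
  ⟨φ.pushforward_eq_zero hf fun x => (φ.interior x).1,
    φ.pushforward_eq_zero hf fun x => (φ.interior x).2⟩

open scoped Classical in
-- An edge of the target either comes from the source or has g = 0 at both ends, so the sum over
-- edges reduces to the source.
lemma push_pull_map {V W E F : Type} [Fintype V] [Fintype E] [Fintype F] (v : V → W) (i : E → F)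
    (hi : Function.Injective i) (ends : E → V × V) (ends' : F → W × W)
    (hends : ∀ e, ends' (i e) = (v (ends e).1, v (ends e).2)) (f : V → ℝ) (g : W → ℝ)
    (hg : ∀ x, g (v x) = f x)
    (hg0 : ∀ e ∉ Set.range i, g (ends' e).1 = 0 ∧ g (ends' e).2 = 0) (y : W) :
    push ends' (pull ends' g - (pull ends' g).swap) y =
      ∑ x, if v x = y then push ends (pull ends f - (pull ends f).swap) x else 0 := by
  have h1 : ∀ x, (if v x = y then push ends (pull ends f - (pull ends f).swap) x else 0) =
      (Set.indicator {x | v x = y} 1 : V → ℝ) x *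
        push ends (pull ends f - (pull ends f).swap) x := fun x => by
    by_cases h : v x = y <;> simp [h]
  simp only [h1]
  have h2 := dotProduct_push ends (pull ends f - (pull ends f).swap)
    (Set.indicator {x | v x = y} 1 : V → ℝ)
  rw [dotProduct] at h2
  rw [h2, push]
  refine (Finset.sum_of_injOn i hi.injOn (by simp) ?_ ?_).symm
  · intro e _ he
    obtain ⟨h3, h4⟩ := hg0 e (by simpa using he)
    simp [pull, h3, h4]
  · intro e _
    simp only [pull, hends, hg, Prod.fst_sub, Prod.snd_sub, Prod.fst_swap, Prod.snd_swap,
      Pi.sub_apply]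
    congr 1
    · by_cases h : v (ends e).1 = y <;> simp [h]
    · by_cases h : v (ends e).2 = y <;> simp [h]

/-- The push-forward of functions that vanish on the boundary commutes with the Laplacian. -/
lemma laplacian_pushforward (φ : Emb A H) {f : A.V → ℝ} (hf : f ∈ A.vanishing) :
    H.laplacian (φ.pushforward f) = φ.pushforward (A.laplacian f) := by
  ext y
  rw [A.laplacian_eq_push, map_add, H.laplacian_eq_push, Pi.add_apply, Pi.add_apply,
    pushforward_apply, pushforward_apply]
  congr 1
  · refine push_pull_map φ.v φ.a φ.a_inj _ _ φ.aEnds_map f _ (φ.pushforward_map hf)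
      (fun e he => ⟨?_, ?_⟩) y
    · exact φ.pushforward_eq_zero hf fun x hx => he (φ.aEdge_mem x e (Or.inl hx.symm))
    · exact φ.pushforward_eq_zero hf fun x hx => he (φ.aEdge_mem x e (Or.inr hx.symm))
  · refine push_pull_map φ.v φ.b φ.b_inj _ _ φ.bEnds_map f _ (φ.pushforward_map hf)
      (fun e he => ⟨?_, ?_⟩) y
    · exact φ.pushforward_eq_zero hf fun x hx => he (φ.bEdge_mem x e (Or.inl hx.symm))
    · exact φ.pushforward_eq_zero hf fun x hx => he (φ.bEdge_mem x e (Or.inr hx.symm))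

lemma pushforward_smul_eq (φ : Emb A H) {f : A.V → ℝ} {μ : ℝ} (hf : f ∈ A.vanishing)
    (h : A.laplacian f = μ • f) :
    H.laplacian (φ.pushforward f) = μ • φ.pushforward f := by
  rw [φ.laplacian_pushforward hf, h, map_smul]

lemma localizedSpectrum_subset (φ : Emb A H) : A.localizedSpectrum ⊆ H.localizedSpectrum := by
  rintro μ ⟨f, hv, hf, h⟩
  refine ⟨φ.pushforward f, φ.pushforward_mem_vanishing hv, fun h0 => hf ?_,
    φ.pushforward_smul_eq hv h⟩
  ext x
  rw [← φ.pushforward_map hv x, h0]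
  rfl

lemma map_localizedSpan_le (φ : Emb A H) (S : Set ℝ) :
    (A.localizedSpan S).map φ.pushforward ≤ H.localizedSpan S := by
  simp only [LabelledGraph.localizedSpan, Submodule.map_iSup]
  refine iSup₂_mono fun μ _ => ?_
  rintro _ ⟨f, ⟨hv, h⟩, rfl⟩
  exact ⟨φ.pushforward_mem_vanishing hv, Module.End.mem_eigenspace_iff.2
    (φ.pushforward_smul_eq hv (Module.End.mem_eigenspace_iff.1 h))⟩

/-- For pairwise disjoint embeddings, the dimensions of localized subspaces add up. -/
lemma sum_finrank_localizedSpan_le {I : Type*} [Fintype I] {src : I → LabelledGraph}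
    (φ : ∀ i, Emb (src i) H) (hφ : Pairwise fun i j => Disj (φ i) (φ j)) (S : Set ℝ) :
    ∑ i, finrank ℝ ((src i).localizedSpan S) ≤ finrank ℝ (H.localizedSpan S) := by
  classical
  let Φ : (∀ i, (src i).localizedSpan S) →ₗ[ℝ] (H.V → ℝ) :=
    ∑ i, (φ i).pushforward ∘ₗ ((src i).localizedSpan S).subtype ∘ₗ LinearMap.proj i
  have hΦ : ∀ f, Φ f = ∑ i, (φ i).pushforward (f i) := fun f => by simp [Φ]
  have hv : ∀ (f : ∀ i, (src i).localizedSpan S) (i), (f i).1 ∈ (src i).vanishing :=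
    fun f i => (src i).localizedSpan_le_vanishing S (f i).2
  have hmem : ∀ f, Φ f ∈ H.localizedSpan S := fun f => by
    rw [hΦ]
    exact sum_mem fun i _ => (φ i).map_localizedSpan_le S ⟨_, (f i).2, rfl⟩
  -- At an interior vertex of one copy the other summands vanish, so each component is recovered
  -- from the sum.
  have hval : ∀ f i, ∀ x : (src i).Interior, Φ f ((φ i).v x) = (f i).1 x := fun f i x => by
    rw [hΦ, Finset.sum_apply, Finset.sum_eq_single i]
    · exact (φ i).pushforward_map (hv f i) x
    · intro j _ hj
      exact (φ j).pushforward_eq_zero (hv f j) fun z hz => (hφ hj).v z x hz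
    · simp
  have hinj : Function.Injective (Φ.codRestrict _ hmem) := by
    rw [← LinearMap.ker_eq_bot, LinearMap.ker_codRestrict, LinearMap.ker_eq_bot']
    intro f hf
    ext i x
    by_cases hx : x ≠ (src i).left ∧ x ≠ (src i).right
    · have := hval f i ⟨x, hx⟩
      rw [hf] at this
      exact this.symm
    · exact apply_eq_zero (hv f i) hx
  rw [← Module.finrank_pi_fintype]
  exact LinearMap.finrank_le_finrank_of_injective hinj

end Emb

/-! ### Small invariant spaces of functions -/

/-- Spaces of functions on the vertices and on the half-edges of a graph that are stable under the
incidence maps and under the exchange of the two halves of every edge; the space of functions on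
the vertices is to contain the indicator functions of the boundary vertices. -/
structure InvariantSystem (G : LabelledGraph) where
  onV : Submodule ℝ (G.V → ℝ)
  onA : Submodule ℝ ((G.AEdge → ℝ) × (G.AEdge → ℝ))
  onB : Submodule ℝ ((G.BEdge → ℝ) × (G.BEdge → ℝ))
  pull_a : ∀ f ∈ onV, pull G.aEnds f ∈ onA
  pull_b : ∀ f ∈ onV, pull G.bEnds f ∈ onB
  swap_a : ∀ h ∈ onA, h.swap ∈ onA
  swap_b : ∀ h ∈ onB, h.swap ∈ onB
  push_a : ∀ h ∈ onA, push G.aEnds h ∈ onV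
  push_b : ∀ h ∈ onB, push G.bEnds h ∈ onV
  left_mem : Set.indicator {G.left} 1 ∈ onV
  right_mem : Set.indicator {G.right} 1 ∈ onV

/-- The functions on edges that have the same value on both halves of every edge. -/
def diagonalPart {E : Type*} (p : Submodule ℝ ((E → ℝ) × (E → ℝ))) : Submodule ℝ (E → ℝ) :=
  p.comap (LinearMap.prod LinearMap.id LinearMap.id)

section PushReplace

variable {V E F : Type*}

lemma indicator_inl_comp_inl (x : V) :
    (Set.indicator {Sum.inl x} 1 : V ⊕ E → ℝ) ∘ Sum.inl = Set.indicator {x} 1 := by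
  ext y
  by_cases h : y = x <;> simp [h]

lemma indicator_inl_comp_inr (x : V) :
    (Set.indicator {Sum.inl x} 1 : V ⊕ E → ℝ) ∘ Sum.inr = 0 := by
  ext y
  simp

variable [Fintype E] [Fintype F]

lemma push_loops_inl (ends : F → V × V) (h : (F ⊕ E → ℝ) × (F ⊕ E → ℝ)) (x : V) :
    push (Sum.elim (fun e => (Sum.inl (ends e).1, Sum.inl (ends e).2))
      (fun e : E => (Sum.inr e, Sum.inr e))) h (Sum.inl x) =
    push ends (h.1 ∘ Sum.inl, h.2 ∘ Sum.inl) x := by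
  classical
  simp [push_apply]

lemma push_loops_inr (ends : F → V × V) (h : (F ⊕ E → ℝ) × (F ⊕ E → ℝ)) (e : E) :
    push (Sum.elim (fun e => (Sum.inl (ends e).1, Sum.inl (ends e).2))
      (fun e : E => (Sum.inr e, Sum.inr e))) h (Sum.inr e) =
    h.1 (Sum.inr e) + h.2 (Sum.inr e) := by
  classical
  simp [push_apply, Finset.sum_add_distrib]

lemma push_halves_inl (ends : E → V × V) (h : (E ⊕ E → ℝ) × (E ⊕ E → ℝ)) (x : V) :
    push (Sum.elim (fun e => (Sum.inl (ends e).1, Sum.inr e))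
      (fun e => (Sum.inr e, Sum.inl (ends e).2))) h (Sum.inl x) =
    push ends (h.1 ∘ Sum.inl, h.2 ∘ Sum.inr) x := by
  classical
  simp [push_apply, Finset.sum_add_distrib]

lemma push_halves_inr (ends : E → V × V) (h : (E ⊕ E → ℝ) × (E ⊕ E → ℝ)) (e : E) :
    push (Sum.elim (fun e => (Sum.inl (ends e).1, Sum.inr e))
      (fun e => (Sum.inr e, Sum.inl (ends e).2))) h (Sum.inr e) =
    h.2 (Sum.inl e) + h.1 (Sum.inr e) := by
  classical
  simp [push_apply]

end PushReplace

namespace InvariantSystem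

variable {G : LabelledGraph}

lemma laplacian_mem (s : InvariantSystem G) {f : G.V → ℝ} (hf : f ∈ s.onV) :
    G.laplacian f ∈ s.onV := by
  rw [G.laplacian_eq_push]
  exact add_mem
    (s.push_a _ (sub_mem (s.pull_a f hf) (s.swap_a _ (s.pull_a f hf))))
    (s.push_b _ (sub_mem (s.pull_b f hf) (s.swap_b _ (s.pull_b f hf))))

/-- All functions. -/
def top (G : LabelledGraph) : InvariantSystem G := by
  refine ⟨⊤, ⊤, ⊤, ?_, ?_, ?_, ?_, ?_, ?_, ?_, ?_⟩ <;> simp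

/-- The sum h + h.swap has h.1 + h.2 on both halves. It is needed at a new vertex, which collects
the inner halves of its two b-edges. -/
lemma add_mem_diagonalPart (s : InvariantSystem G) {h : (G.AEdge → ℝ) × (G.AEdge → ℝ)}
    (hh : h ∈ s.onA) : h.1 + h.2 ∈ diagonalPart s.onA := by
  have := add_mem hh (s.swap_a h hh)
  rwa [Prod.swap, Prod.mk_add_mk, add_comm h.2] at this

/-- The system that a system induces after one application of the replacement rules. -/
def replace (s : InvariantSystem G) : InvariantSystem G.replace where
  onV :=
    { carrier := {f | f ∘ Sum.inl ∈ s.onV ∧ f ∘ Sum.inr ∈ diagonalPart s.onA}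
      add_mem' := fun hf hg => ⟨add_mem hf.1 hg.1, add_mem hf.2 hg.2⟩
      zero_mem' := ⟨zero_mem _, zero_mem _⟩
      smul_mem' := fun c _ hf => ⟨s.onV.smul_mem c hf.1, Submodule.smul_mem _ c hf.2⟩ }
  -- Equal values on the two halves of each new loop: this is where dimension is saved.
  onA :=
    { carrier := {h | (h.1 ∘ Sum.inl, h.2 ∘ Sum.inl) ∈ s.onB ∧
        h.1 ∘ Sum.inr ∈ diagonalPart s.onA ∧ h.2 ∘ Sum.inr = h.1 ∘ Sum.inr}
      add_mem' := fun {h k} hf hg => ⟨add_mem hf.1 hg.1, add_mem hf.2.1 hg.2.1, by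
        ext e; exact congrArg₂ (· + ·) (congrFun hf.2.2 e) (congrFun hg.2.2 e)⟩
      zero_mem' := ⟨zero_mem _, zero_mem _, rfl⟩
      smul_mem' := fun c h hf => ⟨s.onB.smul_mem c hf.1, Submodule.smul_mem _ c hf.2.1, by
        ext e; exact congrArg (c * ·) (congrFun hf.2.2 e)⟩ }
  -- The first condition concerns the halves at the old vertices, the second those at the new
  -- vertex; exchanging halves swaps the two.
  onB :=
    { carrier := {h | (h.1 ∘ Sum.inl, h.2 ∘ Sum.inr) ∈ s.onA ∧
        (h.2 ∘ Sum.inl, h.1 ∘ Sum.inr) ∈ s.onA}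
      add_mem' := fun hf hg => ⟨add_mem hf.1 hg.1, add_mem hf.2 hg.2⟩
      zero_mem' := ⟨zero_mem _, zero_mem _⟩
      smul_mem' := fun c _ hf => ⟨s.onA.smul_mem c hf.1, s.onA.smul_mem c hf.2⟩ }
  pull_a f hf := ⟨s.pull_b _ hf.1, hf.2, rfl⟩
  pull_b f hf := ⟨s.pull_a _ hf.1, hf.2⟩
  swap_a h hh := ⟨s.swap_b _ hh.1, by
    have := hh.2.1
    rw [← hh.2.2] at this
    exact this, hh.2.2.symm⟩
  swap_b h hh := ⟨hh.2, hh.1⟩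
  push_a h hh := by
    constructor
    · convert s.push_b _ hh.1 using 1
      ext x
      exact push_loops_inl G.bEnds h x
    · convert add_mem hh.2.1 hh.2.1 using 1
      ext e
      exact (push_loops_inr G.bEnds h e).trans (congrArg (_ + ·) (congrFun hh.2.2 e))
  push_b h hh := by
    constructor
    · convert s.push_a _ hh.1 using 1
      ext x
      exact push_halves_inl G.aEnds h x
    · convert s.add_mem_diagonalPart hh.2 using 1
      ext e
      exact push_halves_inr G.aEnds h e
  left_mem :=
    ⟨(indicator_inl_comp_inl (E := G.AEdge) G.left).symm ▸ s.left_mem,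
      (indicator_inl_comp_inr (E := G.AEdge) G.left).symm ▸ zero_mem (diagonalPart s.onA)⟩
  right_mem :=
    ⟨(indicator_inl_comp_inl (E := G.AEdge) G.right).symm ▸ s.right_mem,
      (indicator_inl_comp_inr (E := G.AEdge) G.right).symm ▸ zero_mem (diagonalPart s.onA)⟩

lemma orthogonal_le_vanishing (s : InvariantSystem G) : orthogonal s.onV ≤ G.vanishing := by
  intro f hf
  have h1 := mem_orthogonal.1 hf _ s.left_mem
  have h2 := mem_orthogonal.1 hf _ s.right_mem
  classical
  simp only [dotProduct, Set.indicator_apply, Set.mem_singleton_iff, Pi.one_apply, ite_mul, one_mul,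
    zero_mul, Finset.sum_ite_eq', Finset.mem_univ, if_true] at h1 h2
  exact ⟨h1, h2⟩

/-- The orthogonal complement of an invariant system is spanned by localized eigenfunctions. -/
lemma orthogonal_le_localizedSpan (s : InvariantSystem G) {S : Set ℝ}
    (hS : G.localizedSpectrum ⊆ S) : orthogonal s.onV ≤ G.localizedSpan S := by
  rw [orthogonal_eq_iSup_eigenspace G.laplacian G.laplacian_symmetric s.onV
    fun f hf => s.laplacian_mem hf]
  refine iSup_le fun μ => ?_
  rintro f ⟨hf, hμ⟩
  by_cases h0 : f = 0
  · rw [h0]; exact zero_mem _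
  · have hv := s.orthogonal_le_vanishing hf
    exact Submodule.mem_iSup_of_mem μ (Submodule.mem_iSup_of_mem
      (hS ⟨f, hv, h0, Module.End.mem_eigenspace_iff.1 hμ⟩) ⟨hv, hμ⟩)

end InvariantSystem

/-! ### Dimensions -/

lemma finrank_le_add_of_injOn {M N P : Type*} [AddCommGroup M] [Module ℝ M] [AddCommGroup N]
    [Module ℝ N] [Module.Finite ℝ N] [AddCommGroup P] [Module ℝ P] [Module.Finite ℝ P]
    (f : M →ₗ[ℝ] N) (g : M →ₗ[ℝ] P) (s : Submodule ℝ M) (p : Submodule ℝ N) (q : Submodule ℝ P)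
    (hf : ∀ x ∈ s, f x ∈ p) (hg : ∀ x ∈ s, g x ∈ q)
    (h0 : ∀ x ∈ s, f x = 0 → g x = 0 → x = 0) : finrank ℝ s ≤ finrank ℝ p + finrank ℝ q := by
  rw [← Module.finrank_prod]
  let Φ : s →ₗ[ℝ] p × q := (f.restrict hf).prod (g.restrict hg)
  refine LinearMap.finrank_le_finrank_of_injective (f := Φ) ?_
  rw [← LinearMap.ker_eq_bot, LinearMap.ker_eq_bot']
  intro x hx
  exact Subtype.ext (h0 x x.2 (congrArg Subtype.val (congrArg Prod.fst hx))
    (congrArg Subtype.val (congrArg Prod.snd hx)))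

lemma eq_zero_of_comp_inl_inr {α β : Type*} {f : α ⊕ β → ℝ} (h1 : f ∘ Sum.inl = 0)
    (h2 : f ∘ Sum.inr = 0) : f = 0 := by
  ext (x | x)
  · exact congrFun h1 x
  · exact congrFun h2 x

namespace InvariantSystem

variable {G : LabelledGraph} (s : InvariantSystem G)

lemma finrank_onV_replace :
    finrank ℝ s.replace.onV ≤ finrank ℝ s.onV + finrank ℝ (diagonalPart s.onA) :=
  finrank_le_add_of_injOn (LinearMap.funLeft ℝ ℝ Sum.inl) (LinearMap.funLeft ℝ ℝ Sum.inr) _ _ _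
    (fun _ h => h.1) (fun _ h => h.2) fun _ _ h1 h2 => eq_zero_of_comp_inl_inr h1 h2

/-- The loops cost only the dimension of the diagonal part, since one half determines the other. -/
lemma finrank_onA_replace :
    finrank ℝ s.replace.onA ≤ finrank ℝ s.onB + finrank ℝ (diagonalPart s.onA) :=
  finrank_le_add_of_injOn
    ((LinearMap.funLeft ℝ ℝ Sum.inl).prodMap (LinearMap.funLeft ℝ ℝ Sum.inl))
    (LinearMap.funLeft ℝ ℝ Sum.inr ∘ₗ LinearMap.fst ℝ _ _) _ _ _
    (fun _ h => h.1) (fun _ h => h.2.1) fun _ h h1 h2 => Prod.ext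
      (eq_zero_of_comp_inl_inr (congrArg Prod.fst h1) h2)
      (eq_zero_of_comp_inl_inr (congrArg Prod.snd h1) (h.2.2.trans h2))

lemma finrank_onB_replace :
    finrank ℝ s.replace.onB ≤ finrank ℝ s.onA + finrank ℝ s.onA :=
  finrank_le_add_of_injOn
    ((LinearMap.funLeft ℝ ℝ Sum.inl).prodMap (LinearMap.funLeft ℝ ℝ Sum.inr))
    (((LinearMap.funLeft ℝ ℝ Sum.inl).prodMap (LinearMap.funLeft ℝ ℝ Sum.inr)) ∘ₗ
      (LinearEquiv.prodComm ℝ _ _).toLinearMap) _ _ _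
    (fun _ h => h.1) (fun _ h => h.2) fun _ _ h1 h2 => Prod.ext
      (eq_zero_of_comp_inl_inr (congrArg Prod.fst h1) (congrArg Prod.snd h2))
      (eq_zero_of_comp_inl_inr (congrArg Prod.fst h2) (congrArg Prod.snd h1))

lemma finrank_diagonalPart_onA_replace :
    finrank ℝ (diagonalPart s.replace.onA) ≤
      finrank ℝ (diagonalPart s.onB) + finrank ℝ (diagonalPart s.onA) :=
  finrank_le_add_of_injOn (LinearMap.funLeft ℝ ℝ Sum.inl) (LinearMap.funLeft ℝ ℝ Sum.inr) _ _ _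
    (fun _ h => h.1) (fun _ h => h.2.1) fun _ _ h1 h2 => eq_zero_of_comp_inl_inr h1 h2

/-- On the diagonal the outer halves determine the inner ones, so a single copy of `s.onA` is
enough. -/
lemma finrank_diagonalPart_onB_replace :
    finrank ℝ (diagonalPart s.replace.onB) ≤ finrank ℝ s.onA := by
  have := finrank_le_add_of_injOn
    ((LinearMap.funLeft ℝ ℝ Sum.inl).prod (LinearMap.funLeft ℝ ℝ Sum.inr))
    (0 : (G.replace.BEdge → ℝ) →ₗ[ℝ] (G.replace.BEdge → ℝ)) (diagonalPart s.replace.onB) s.onA ⊥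
    (fun _ h => h.1) (fun _ h => rfl) fun _ _ h1 h2 =>
      eq_zero_of_comp_inl_inr (congrArg Prod.fst h1) (congrArg Prod.snd h1)
  rw [finrank_bot] at this
  exact this

/-- A weighted sum of the dimensions, which grows by a factor of at most `19 / 10` under the
replacement rules. -/
def weight : ℝ :=
  0.3 * finrank ℝ s.onV + finrank ℝ s.onA + 0.53 * finrank ℝ s.onB +
    1.5 * finrank ℝ (diagonalPart s.onA) + 0.84 * finrank ℝ (diagonalPart s.onB)

/-- The dimension recursion has growth rate 2cos(π/7) ≈ 1.802, the largest root of x³ = x² + 2x - 1.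
The coefficients of `weight` are chosen so that each one grows by at most the factor 1.9, which only
has to stay below 2. -/
lemma weight_replace : s.replace.weight ≤ 1.9 * s.weight := by
  have h1 : (finrank ℝ s.replace.onV : ℝ) ≤ _ := Nat.cast_le.2 s.finrank_onV_replace
  have h2 : (finrank ℝ s.replace.onA : ℝ) ≤ _ := Nat.cast_le.2 s.finrank_onA_replace
  have h3 : (finrank ℝ s.replace.onB : ℝ) ≤ _ := Nat.cast_le.2 s.finrank_onB_replace
  have h4 : (finrank ℝ (diagonalPart s.replace.onA) : ℝ) ≤ _ :=
    Nat.cast_le.2 s.finrank_diagonalPart_onA_replace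
  have h5 : (finrank ℝ (diagonalPart s.replace.onB) : ℝ) ≤ _ :=
    Nat.cast_le.2 s.finrank_diagonalPart_onB_replace
  push_cast at h1 h2 h3 h4 h5
  have p1 : (0 : ℝ) ≤ finrank ℝ s.onV := Nat.cast_nonneg _
  have p2 : (0 : ℝ) ≤ finrank ℝ s.onA := Nat.cast_nonneg _
  have p3 : (0 : ℝ) ≤ finrank ℝ s.onB := Nat.cast_nonneg _
  have p4 : (0 : ℝ) ≤ finrank ℝ (diagonalPart s.onA) := Nat.cast_nonneg _
  have p5 : (0 : ℝ) ≤ finrank ℝ (diagonalPart s.onB) := Nat.cast_nonneg _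
  unfold weight
  linarith

end InvariantSystem

/-- The invariant system on `G_n` that all functions on `G_0` induce. -/
def system : ∀ n, InvariantSystem (G n)
  | 0 => InvariantSystem.top (G 0)
  | n + 1 => (system n).replace

lemma weight_system_le (n : ℕ) : (system n).weight ≤ 4.1 * 1.9 ^ n := by
  induction n with
  | zero =>
    have h1 : finrank ℝ (system 0).onV ≤ 2 := (Submodule.finrank_le _).trans_eq
      (by rw [Module.finrank_fintype_fun_eq_card]; rfl)
    have h2 : finrank ℝ (system 0).onA ≤ 2 := (Submodule.finrank_le _).trans_eq
      (by rw [Module.finrank_prod, Module.finrank_fintype_fun_eq_card]; rfl)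
    have h3 : finrank ℝ (system 0).onB ≤ 0 := (Submodule.finrank_le _).trans_eq
      (by rw [Module.finrank_prod, Module.finrank_fintype_fun_eq_card]; rfl)
    have h4 : finrank ℝ (diagonalPart (system 0).onA) ≤ 1 := (Submodule.finrank_le _).trans_eq
      (by rw [Module.finrank_fintype_fun_eq_card]; rfl)
    have h5 : finrank ℝ (diagonalPart (system 0).onB) ≤ 0 := (Submodule.finrank_le _).trans_eq
      (by rw [Module.finrank_fintype_fun_eq_card]; rfl)
    -- 0.3 · 2 + 2 + 1.5 · 1 = 4.1.
    unfold InvariantSystem.weight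
    rify at h1 h2 h3 h4 h5
    linarith
  | succ n ih =>
    refine (system n).weight_replace.trans ?_
    rw [pow_succ]
    linarith

lemma finrank_system_le (n : ℕ) : (finrank ℝ (system n).onV : ℝ) ≤ 14 * 1.9 ^ n := by
  have h := weight_system_le n
  unfold InvariantSystem.weight at h
  have p2 : (0 : ℝ) ≤ finrank ℝ (system n).onA := Nat.cast_nonneg _
  have p3 : (0 : ℝ) ≤ finrank ℝ (system n).onB := Nat.cast_nonneg _
  have p4 : (0 : ℝ) ≤ finrank ℝ (diagonalPart (system n).onA) := Nat.cast_nonneg _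
  have p5 : (0 : ℝ) ≤ finrank ℝ (diagonalPart (system n).onB) := Nat.cast_nonneg _
  have : (0 : ℝ) < 1.9 ^ n := by positivity
  -- 4.1 / 0.3 < 14.
  linarith

/-- All but at most `14 * 1.9 ^ n` dimensions are spanned by localized eigenfunctions. -/
lemma card_le_finrank_localizedSpan (n : ℕ) {S : Set ℝ} (hS : (G n).localizedSpectrum ⊆ S) :
    (Fintype.card (G n).V : ℝ) ≤ finrank ℝ ((G n).localizedSpan S) + 14 * 1.9 ^ n := by
  have h1 := card_le_finrank_add_finrank_orthogonal (system n).onV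
  have h2 := Submodule.finrank_mono ((system n).orthogonal_le_localizedSpan hS)
  have h3 := finrank_system_le n
  have h4 : (Fintype.card (G n).V : ℝ) ≤
      finrank ℝ (system n).onV + finrank ℝ ((G n).localizedSpan S) := by
    exact_mod_cast h1.trans (by omega)
  linarith

/-! ### The numbers of vertices and edges of `G_n` -/

lemma card_V_succ (n : ℕ) :
    Fintype.card (G (n + 1)).V = Fintype.card (G n).V + Fintype.card (G n).AEdge :=
  Fintype.card_sum

lemma card_AEdge_succ (n : ℕ) :
    Fintype.card (G (n + 1)).AEdge = Fintype.card (G n).BEdge + Fintype.card (G n).AEdge :=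
  Fintype.card_sum

lemma card_BEdge_succ (n : ℕ) :
    Fintype.card (G (n + 1)).BEdge = Fintype.card (G n).AEdge + Fintype.card (G n).AEdge :=
  Fintype.card_sum

lemma card_V_zero : Fintype.card (G 0).V = 2 := rfl

lemma card_AEdge_zero : Fintype.card (G 0).AEdge = 1 := rfl

lemma card_BEdge_zero : Fintype.card (G 0).BEdge = 0 := rfl

lemma two_mul_card_AEdge_add_card_BEdge (n : ℕ) :
    2 * Fintype.card (G n).AEdge + Fintype.card (G n).BEdge = 2 * 2 ^ n := by
  induction n with
  | zero => rfl
  | succ n ih => rw [card_AEdge_succ, card_BEdge_succ, pow_succ]; omega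

lemma pow_le_two_mul_card_AEdge (n : ℕ) : 2 ^ n ≤ 2 * Fintype.card (G n).AEdge := by
  cases n with
  | zero => simp [card_AEdge_zero]
  | succ n =>
    have := two_mul_card_AEdge_add_card_BEdge n
    rw [card_AEdge_succ, pow_succ]; omega

lemma card_V_le (n : ℕ) : Fintype.card (G n).V ≤ 2 * 2 ^ n := by
  induction n with
  | zero => rfl
  | succ n ih =>
    have := two_mul_card_AEdge_add_card_BEdge n
    rw [card_V_succ, pow_succ]; omega

lemma two_le_card_V (n : ℕ) : 2 ≤ Fintype.card (G n).V := by
  induction n with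
  | zero => rfl
  | succ n ih => rw [card_V_succ]; omega

/-- The summand 8 leaves room for the two boundary vertices, so the bound also serves the Dirichlet
dimension. -/
lemma pow_le_card_V (n : ℕ) : 2 ^ (n + 1) + 8 ≤ 4 * Fintype.card (G (n + 1)).V := by
  have h1 := two_le_card_V n
  have h2 := pow_le_two_mul_card_AEdge n
  rw [card_V_succ, pow_succ]; omega

/-- `G_{k + m + 1}` consists of `G_k` with `a`-edges replaced by copies of `G_{m + 1}` and `b`-edges
replaced by copies of `G_m`. -/
lemma card_add (k m : ℕ) :
    (Fintype.card (G (k + (m + 1))).V + 2 * (Fintype.card (G k).AEdge + Fintype.card (G k).BEdge) =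
      Fintype.card (G k).V + Fintype.card (G k).AEdge * Fintype.card (G (m + 1)).V +
        Fintype.card (G k).BEdge * Fintype.card (G m).V) ∧
    (Fintype.card (G (k + (m + 1))).AEdge =
      Fintype.card (G k).AEdge * Fintype.card (G (m + 1)).AEdge +
        Fintype.card (G k).BEdge * Fintype.card (G m).AEdge) ∧
    Fintype.card (G (k + (m + 1))).BEdge =
      Fintype.card (G k).AEdge * Fintype.card (G (m + 1)).BEdge +
        Fintype.card (G k).BEdge * Fintype.card (G m).BEdge := by
  -- The boundary vertices of each copy are already counted in G_k; this overcount of two per edge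
  -- stands on the left to avoid subtraction.
  induction m with
  | zero =>
    simp only [zero_add, card_V_succ k, card_AEdge_succ k, card_BEdge_succ k, card_V_succ 0,
      card_AEdge_succ 0, card_BEdge_succ 0, card_V_zero, card_AEdge_zero, card_BEdge_zero]
    refine ⟨by ring, by ring, by ring⟩
  | succ m ih =>
    obtain ⟨h1, h2, h3⟩ := ih
    rw [← add_assoc k, card_V_succ (k + (m + 1)), card_AEdge_succ (k + (m + 1)),
      card_BEdge_succ (k + (m + 1)), h2, h3, card_V_succ (m + 1), card_AEdge_succ (m + 1),
      card_BEdge_succ (m + 1)]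
    rw [card_V_succ m, card_AEdge_succ m, card_BEdge_succ m] at *
    refine ⟨?_, by ring, by ring⟩
    linear_combination h1

lemma left_ne_right (n : ℕ) : (G n).left ≠ (G n).right := by
  induction n with
  | zero => simp [G]
  | succ n ih => exact fun h => ih (Sum.inl_injective h)

lemma finrank_interior_add_two (n : ℕ) :
    finrank ℝ ((G n).Interior → ℝ) + 2 = Fintype.card (G n).V := by
  classical
  rw [Module.finrank_fintype_fun_eq_card, Fintype.card_subtype]
  have h : (Finset.univ.filter fun x => x ≠ (G n).left ∧ x ≠ (G n).right) =
      Finset.univ \ {(G n).left, (G n).right} := by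
    ext x; simp
  rw [h, Finset.card_sdiff_of_subset (Finset.subset_univ _), Finset.card_pair (left_ne_right n),
    Finset.card_univ]
  have := two_le_card_V n
  omega

/-! ### The copies of `G_m` in `G_n` -/

/-- The copy of `G_m` in `G_{k + m}` that arises from an `a`-edge of `G_k`. -/
def embA (k : ℕ) (e : (G k).AEdge) : ∀ m, Emb (G m) (G (k + m))
  | 0 => Emb.ofAEdge (G k) e
  | m + 1 => (embA k e m).replace

/-- The copy of `G_m` in `G_{k + m + 1}` that arises from a `b`-edge of `G_k`. -/
def embB (k : ℕ) (e : (G k).BEdge) : ∀ m, Emb (G m) (G (k + (m + 1)))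
  | 0 => Emb.ofAEdge (G (k + 1)) (Sum.inl e)
  | m + 1 => (embB k e m).replace

/-- The copy of `G_m` in `G_{m + 1}` that arises from the loop of `G_1`. -/
def embLoop : ∀ m, Emb (G m) (G (m + 1))
  | 0 => Emb.ofAEdge (G 1) (Sum.inr ())
  | m + 1 => (embLoop m).replace

lemma interior_zero (x : (G 0).Interior) : False := by
  obtain ⟨_ | _, h⟩ := x <;> simp [G] at h

lemma disj_embA_embA (k : ℕ) {e e' : (G k).AEdge} (h : e ≠ e') (m : ℕ) :
    Emb.Disj (embA k e m) (embA k e' m) := by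
  induction m with
  | zero => exact ⟨fun x => (interior_zero x).elim, fun _ _ => h, fun x => x.elim⟩
  | succ m ih => exact ih.replace

lemma disj_embB_embB (k : ℕ) {e e' : (G k).BEdge} (h : e ≠ e') (m : ℕ) :
    Emb.Disj (embB k e m) (embB k e' m) := by
  induction m with
  | zero => exact ⟨fun x => (interior_zero x).elim, fun _ _ h' => h (Sum.inl_injective h'),
      fun x => x.elim⟩
  | succ m ih => exact ih.replace

lemma disj_embB_embA (k : ℕ) (e : (G k).BEdge) (e' : (G k).AEdge) (m : ℕ) :
    Emb.Disj (embB k e m) (embA k e' (m + 1)) := by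
  induction m with
  | zero =>
    -- In G_{k+1} a relabelled b-edge is a left summand, whereas the only a-edge of a copy of G_1 is
    -- its loop, a right summand.
    refine ⟨fun x => (interior_zero x).elim, ?_, fun x => x.elim⟩
    rintro _ (y | y) h
    · exact y.elim
    · exact Sum.inl_ne_inr h
  | succ m ih => exact ih.replace

/-- The localized eigenfunctions with eigenvalues in the localized spectrum of `G_m` span a space of
small codimension. -/
lemma card_sub_finrank_localizedSpan_le (k m : ℕ) :
    (Fintype.card (G (k + (m + 1))).V : ℝ) -
      finrank ℝ ((G (k + (m + 1))).localizedSpan (G (m + 1)).localizedSpectrum) ≤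
      30 * 2 ^ k * 1.9 ^ (m + 1) := by
  set S := (G (m + 1)).localizedSpectrum
  let src : (G k).AEdge ⊕ (G k).BEdge → LabelledGraph :=
    Sum.elim (fun _ => G (m + 1)) (fun _ => G m)
  let φ : ∀ i, Emb (src i) (G (k + (m + 1)))
    | Sum.inl e => embA k e (m + 1)
    | Sum.inr e => embB k e m
  have hφ : Pairwise fun i j => Emb.Disj (φ i) (φ j) := by
    rintro (i | i) (j | j) hij
    · exact disj_embA_embA k (fun h => hij (congrArg _ h)) _
    · exact (disj_embB_embA k j i m).symm
    · exact disj_embB_embA k i j m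
    · exact disj_embB_embB k (fun h => hij (congrArg _ h)) _
  have h : Fintype.card (G k).AEdge * finrank ℝ ((G (m + 1)).localizedSpan S) +
      Fintype.card (G k).BEdge * finrank ℝ ((G m).localizedSpan S) ≤
      finrank ℝ ((G (k + (m + 1))).localizedSpan S) := by
    refine le_trans (le_of_eq ?_) (Emb.sum_finrank_localizedSpan_le φ hφ S)
    rw [Fintype.sum_sum_type]
    exact congrArg₂ (· + ·) (Finset.sum_const _).symm (Finset.sum_const _).symm
  have h1 := card_le_finrank_localizedSpan (m + 1) (S := S) subset_rfl
  -- The smaller copies, grown from b-edges, bring no new eigenvalues: G_m sits in G_{m+1} over the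
  -- loop of G_1.
  have h2 := card_le_finrank_localizedSpan m (S := S) (embLoop m).localizedSpectrum_subset
  have h3 := (card_add k m).1
  have h4 := two_mul_card_AEdge_add_card_BEdge k
  have h5 := card_V_le k
  rify at h h3 h4 h5
  have ha : (0 : ℝ) ≤ Fintype.card (G k).AEdge := Nat.cast_nonneg _
  have hb : (0 : ℝ) ≤ Fintype.card (G k).BEdge := Nat.cast_nonneg _
  have hp : (1 : ℝ) ≤ 1.9 ^ (m + 1) := one_le_pow₀ (by norm_num)
  have hp' : (1.9 : ℝ) ^ m ≤ 1.9 ^ (m + 1) := pow_le_pow_right₀ (by norm_num) (by omega)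
  have h2' : (Fintype.card (G m).V : ℝ) ≤ finrank ℝ ((G m).localizedSpan S) + 14 * 1.9 ^ (m + 1) :=
    by linarith
  have h6 := mul_le_mul_of_nonneg_left h1 ha
  have h7 := mul_le_mul_of_nonneg_left h2' hb
  set P : ℝ := 1.9 ^ (m + 1)
  have hk : (0 : ℝ) < 2 ^ k := by positivity
  have h8 : ((Fintype.card (G k).AEdge : ℝ) + Fintype.card (G k).BEdge) * P ≤ 2 * 2 ^ k * P :=
    mul_le_mul_of_nonneg_right (by linarith) (by linarith)
  have h9 : (2 : ℝ) ^ k ≤ 2 ^ k * P := le_mul_of_one_le_right hk.le hp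
  -- 28 · 2^k · P comes from the at most 2 · 2^k copies, and 2 · 2^k ≤ 2 · 2^k · P from the vertices
  -- of G_k.
  linarith

/-- Since 1.9 = 2 · 0.95, the codimension is compared with 2^(k+m+1) / 4 ≤ |V| - 2, which bounds
both the Neumann and the Dirichlet dimension from below. -/
lemma card_sub_finrank_localizedSpan_le_mul (k m : ℕ) :
    (Fintype.card (G (k + (m + 1))).V : ℝ) -
      finrank ℝ ((G (k + (m + 1))).localizedSpan (G (m + 1)).localizedSpectrum) ≤
      120 * 0.95 ^ (m + 1) * (Fintype.card (G (k + (m + 1))).V - 2) := by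
  refine (card_sub_finrank_localizedSpan_le k m).trans ?_
  have h1 := pow_le_card_V (k + m)
  rw [add_assoc] at h1
  rify at h1
  have h2 : (30 : ℝ) * 2 ^ k * 1.9 ^ (m + 1) =
      120 * 0.95 ^ (m + 1) * (2 ^ (k + (m + 1)) / 4) := by
    rw [pow_add 2 k, show (1.9 : ℝ) = 0.95 * 2 by norm_num, mul_pow]
    ring
  rw [h2]
  gcongr
  linarith

/-! ### Bounds for the spectral measures -/

lemma spectralMeasure_laplacian_le {m n : ℕ} (hm : 1 ≤ m) (hn : m ≤ n) :
    spectralMeasure (G n).laplacian (G m).localizedSpectrumᶜ ≤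
      ENNReal.ofReal (120 * 0.95 ^ m) := by
  obtain ⟨m, rfl⟩ := Nat.exists_eq_add_of_le' hm
  obtain ⟨k, rfl⟩ := Nat.exists_eq_add_of_le' hn
  refine spectralMeasure_compl_le _ _ ?_ _ (LabelledGraph.localizedSpan_le _ _) ?_ ?_
  · exact ((finite_eigenvalues _).subset
      (G (m + 1)).localizedSpectrum_subset_eigenvalues).measurableSet
  · rw [Module.finrank_fintype_fun_eq_card]
    have := two_le_card_V (k + (m + 1))
    omega
  · rw [Module.finrank_fintype_fun_eq_card]
    refine (card_sub_finrank_localizedSpan_le_mul k m).trans ?_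
    gcongr
    linarith

lemma spectralMeasure_dirichletLaplacian_le {m n : ℕ} (hm : 1 ≤ m) (hn : m ≤ n) :
    spectralMeasure (G n).dirichletLaplacian (G m).localizedSpectrumᶜ ≤
      ENNReal.ofReal (120 * 0.95 ^ m) := by
  obtain ⟨m, rfl⟩ := Nat.exists_eq_add_of_le' hm
  obtain ⟨k, rfl⟩ := Nat.exists_eq_add_of_le' hn
  have h := finrank_interior_add_two (k + (m + 1))
  refine spectralMeasure_compl_le _ _ ?_ _ (LabelledGraph.map_restrict_localizedSpan_le _ _) ?_ ?_
  · exact ((finite_eigenvalues _).subset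
      (G (m + 1)).localizedSpectrum_subset_eigenvalues).measurableSet
  · have := pow_le_card_V (k + m)
    rw [add_assoc] at this
    have : 0 < 2 ^ (k + (m + 1)) := by positivity
    omega
  · rw [LabelledGraph.finrank_map_restrict_localizedSpan]
    have h1 := card_sub_finrank_localizedSpan_le_mul k m
    rw [← h] at h1
    push_cast at h1
    rw [add_sub_cancel_right] at h1
    linarith

lemma isProbabilityMeasure_spectralMeasure_laplacian (n : ℕ) :
    IsProbabilityMeasure (spectralMeasure (G n).laplacian) := by
  refine isProbabilityMeasure_spectralMeasure _
    (iSup_eigenspace_eq_top_of_symmetric _ (G n).laplacian_symmetric) ?_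
  rw [Module.finrank_fintype_fun_eq_card]
  have := two_le_card_V n
  omega

/-- Portmanteau: the mass of an open set under the limit is at most the liminf of the masses. It
applies to complements of finite sets of eigenvalues. -/
lemma IsKNSMeasure.measure_le {χ : Measure ℝ} (hχ : IsKNSMeasure χ) {U : Set ℝ} (hU : IsOpen U)
    {δ : ℝ≥0∞} {m : ℕ} (h : ∀ n, m ≤ n → spectralMeasure (G n).laplacian U ≤ δ) : χ U ≤ δ := by
  obtain ⟨hp, hχ⟩ := hχ
  let μs : ℕ → ProbabilityMeasure ℝ := fun n => ⟨spectralMeasure (G n).laplacian,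
    isProbabilityMeasure_spectralMeasure_laplacian n⟩
  let χ' : ProbabilityMeasure ℝ := ⟨χ, hp⟩
  have hlim : Tendsto μs atTop (𝓝 χ') :=
    ProbabilityMeasure.tendsto_iff_forall_integral_tendsto.2 hχ
  refine (ProbabilityMeasure.le_liminf_measure_open_of_tendsto hlim hU).trans ?_
  exact liminf_le_of_frequently_le'
    ((eventually_ge_atTop m).mono fun n hn => h n hn).frequently

lemma IsKNSMeasure.compl_localizedSpectrum_le {χ : Measure ℝ} (hχ : IsKNSMeasure χ) {m : ℕ}
    (hm : 1 ≤ m) : χ (G m).localizedSpectrumᶜ ≤ ENNReal.ofReal (120 * 0.95 ^ m) := by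
  refine hχ.measure_le (m := m) ?_ fun n hn => spectralMeasure_laplacian_le hm hn
  exact ((finite_eigenvalues _).subset
    (G m).localizedSpectrum_subset_eigenvalues).isClosed.isOpen_compl

/-- From 0.95 ≤ exp(-0.05) and 200 · 0.05 = 10, the power is at most exp(-10 - 10 |log ε|) ≤
exp(-10) ε, and exp 10 absorbs the factor 120. -/
lemma mul_pow_le_of_log_le {ε : ℝ} (hε : 0 < ε) {m : ℕ}
    (hm : 200 * (1 + |Real.log ε|) ≤ m) : 120 * 0.95 ^ m ≤ ε := by
  have h1 : (0.95 : ℝ) ≤ Real.exp (-0.05) := by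
    have := Real.add_one_le_exp (-0.05)
    linarith
  have h2 : (0.95 : ℝ) ^ m ≤ Real.exp (-10 + Real.log ε) := by
    calc (0.95 : ℝ) ^ m ≤ Real.exp (-0.05) ^ m := by gcongr
      _ = Real.exp (m * -0.05) := (Real.exp_nat_mul _ _).symm
      _ ≤ _ := by
        have := neg_abs_le (Real.log ε)
        have := abs_nonneg (Real.log ε)
        exact Real.exp_le_exp.2 (by linarith)
  have h3 : (120 : ℝ) ≤ Real.exp 10 := by
    have h := Real.add_one_le_exp 1
    calc (120 : ℝ) ≤ 2 ^ 10 := by norm_num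
      _ ≤ Real.exp 1 ^ 10 := by gcongr; linarith
      _ = Real.exp 10 := by rw [← Real.exp_nat_mul]; norm_num
  calc 120 * 0.95 ^ m ≤ Real.exp 10 * Real.exp (-10 + Real.log ε) := by gcongr
    _ = ε := by rw [← Real.exp_add, add_neg_cancel_left, Real.exp_log hε]

end Basilica

end

theorem mainTheorem6 :
    ∃ c C : ℝ, 0 < c ∧ 0 < C ∧ ∀ ε : ℝ, 0 < ε →
      ∃ m : ℕ, 1 ≤ m ∧ c * |Real.log ε| ≤ (m : ℝ) ∧ (m : ℝ) ≤ C * (1 + |Real.log ε|) ∧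
        (∀ n : ℕ, m ≤ n →
          Basilica.spectralMeasure (Basilica.G n).dirichletLaplacian
              (Basilica.eigenvalues (Basilica.G m).dirichletLaplacian)ᶜ ≤ ENNReal.ofReal ε ∧
          Basilica.spectralMeasure (Basilica.G n).laplacian
              (Basilica.eigenvalues (Basilica.G m).laplacian)ᶜ ≤ ENNReal.ofReal ε) ∧
        (∀ χ : MeasureTheory.Measure ℝ, Basilica.IsKNSMeasure χ →
          χ (Basilica.eigenvalues (Basilica.G m).dirichletLaplacian)ᶜ ≤ ENNReal.ofReal ε ∧
          χ (Basilica.eigenvalues (Basilica.G m).laplacian)ᶜ ≤ ENNReal.ofReal ε) := by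
  -- C = 201 is 200 plus one for rounding up; c = 1 is far from tight.
  refine ⟨1, 201, one_pos, by norm_num, fun ε hε => ?_⟩
  have h0 := abs_nonneg (Real.log ε)
  have h1 := Nat.le_ceil (200 * (1 + |Real.log ε|))
  have h2 := Nat.ceil_lt_add_one (a := 200 * (1 + |Real.log ε|)) (by positivity)
  set m := ⌈200 * (1 + |Real.log ε|)⌉₊
  have hm : 1 ≤ m := by
    have : (1 : ℝ) ≤ m := by linarith
    exact_mod_cast this
  have hε' := ENNReal.ofReal_le_ofReal (Basilica.mul_pow_le_of_log_le hε h1)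
  -- Both sets of eigenvalues contain the localized spectrum of G_m, so bounding the mass off that
  -- one set settles all four claims.
  have hN := Set.compl_subset_compl.2 (Basilica.G m).localizedSpectrum_subset_eigenvalues
  have hD := Set.compl_subset_compl.2 (Basilica.G m).localizedSpectrum_subset_eigenvalues_dirichlet
  refine ⟨m, hm, by linarith, by linarith, fun n hn => ⟨?_, ?_⟩, fun χ hχ => ⟨?_, ?_⟩⟩
  · exact (measure_mono hD).trans
      ((Basilica.spectralMeasure_dirichletLaplacian_le hm hn).trans hε')
  · exact (measure_mono hN).trans ((Basilica.spectralMeasure_laplacian_le hm hn).trans hε')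
  · exact (measure_mono hD).trans ((hχ.compl_localizedSpectrum_le hm).trans hε')
  · exact (measure_mono hN).trans ((hχ.compl_localizedSpectrum_le hm).trans hε')
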